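/- There is a universal constant $C<\infty$ such that the following holds. Let $n\ge 0$, $U=[n]$, let $X_1,\dots,X_n$ be independent random variables with values in $\mathbb{R}_{\ge 0}$ (with arbitrary, possibly different distributions), let $f:\mathbb{R}_{\ge 0}^U\to\mathbb{R}_{\ge 0}$ be a monotone symmetric norm, that is, $f(\mathbf 0)=0$, $f(u)\le f(v)$ whenever $u\le v$ coordinatewise, $f(u+v)\le f(u)+f(v)$, $f(\theta v)=\theta f(v)$ for $\theta\ge 0$, and $f$ is invariant under permutations of the coordinates, and let $\mathcal F$ be a prefix-closed set of sequences of distinct elements of $U$ (every prefix of a member of $\mathcal F$ is in $\mathcal F$). For a set or sequence $P$ of elements, let $X_P\in\mathbb{R}_{\ge 0}^U$ have $i$-th coordinate $X_i$ if $i\in P$ and $0$ otherwise. An adaptive strategy is a (measurable) decision tree: at each internal node it probes an element $i$, observes the value of $X_i$, and moves to a child determined by that value; at a leaf it stops. It is feasible if the sequence of elements on each root-to-leaf path lies in $\mathcal F$. If $P$ is the (random) sequence of elements probed, its expected reward is $\mathbb{E}[f(X_P)]\in[0,\infty]$. Let $\mathsf{OPT}_{\mathrm{adap}}$ be the supremum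 of the expected reward over all feasible adaptive strategies, and let $\mathsf{OPT}_{\mathrm{nonadap}}=\sup_{F\in\mathcal F}\mathbb{E}[f(X_F)]$ be the optimal expected reward of a non-adaptive strategy, which fixes a sequence $F\in\mathcal F$ in advance (a supremum over the empty set is $0$). Then $$\mathsf{OPT}_{\mathrm{adap}}\le C\cdot \mathsf{OPT}_{\mathrm{nonadap}},$$ i.e. the adaptivity gap of stochastic probing with a monotone symmetric norm objective and any prefix-closed constraint is at most $C=O(1)$, where $C$ does not depend on $n$, the distributions, $f$ or $\mathcal F$. -/

import Mathlib

open MeasureTheory ProbabilityTheory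
open scoped NNReal ENNReal

namespace StochasticProbing

/-- A monotone symmetric norm objective on the nonnegative orthant `ℝ≥0^ι`. -/
structure IsSymmetricNorm {ι : Type*} (f : (ι → ℝ≥0) → ℝ≥0) : Prop where
  map_zero : f 0 = 0
  mono : ∀ u v : ι → ℝ≥0, u ≤ v → f u ≤ f v
  subadd : ∀ u v : ι → ℝ≥0, f (u + v) ≤ f u + f v
  homog : ∀ (θ : ℝ≥0) (v : ι → ℝ≥0), f (θ • v) = θ * f v
  symm : ∀ (π : Equiv.Perm ι) (v : ι → ℝ≥0), f (fun i => v (π i)) = f v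

/-- A prefix-closed feasibility constraint: a set of sequences of distinct elements of `ι`
that contains all prefixes of its members. -/
structure IsPrefixClosed {ι : Type*} (𝓕 : Set (List ι)) : Prop where
  nodup : ∀ F ∈ 𝓕, F.Nodup
  prefix_mem : ∀ F ∈ 𝓕, ∀ G : List ι, G <+: F → G ∈ 𝓕

/-- A (deterministic) adaptive strategy as a decision tree: either stop, or probe an element `i`
and continue with a subtree that depends on the observed value of `X i`. -/
inductive Strategy (ι : Type*) : Type _
  | leaf : Strategy ι
  | probe (i : ι) (next : ℝ≥0 → Strategy ι) : Strategy ι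

/-- The root-to-leaf path (sequence of probed elements) that the strategy follows when the
variables are realized to the vector `x`. -/
def Strategy.path {ι : Type*} : Strategy ι → (ι → ℝ≥0) → List ι
  | .leaf, _ => []
  | .probe i next, x => i :: Strategy.path (next (x i)) x

/-- Every root-to-leaf path of the tree is a feasible sequence of probes. -/
def Strategy.Feasible {ι : Type*} (𝓕 : Set (List ι)) (T : Strategy ι) : Prop :=
  ∀ x : ι → ℝ≥0, T.path x ∈ 𝓕

/-- The strategy makes measurable decisions: for each sequence `F`, the set of outcomes on which
exactly `F` is probed is measurable. -/
def Strategy.IsMeasurable {ι : Type*} (T : Strategy ι) : Prop :=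
  ∀ F : List ι, MeasurableSet {x : ι → ℝ≥0 | T.path x = F}

/-- The vector `x_P`: equal to `x i` on probed elements and to `0` elsewhere. -/
def reveal {ι : Type*} [DecidableEq ι] (P : List ι) (x : ι → ℝ≥0) : ι → ℝ≥0 :=
  fun i => if i ∈ P then x i else 0

/-- `E[f(X_P)]` where `P` is the random sequence probed by the adaptive strategy `T`. -/
noncomputable def adaptiveReward {ι Ω : Type*} [DecidableEq ι] [MeasurableSpace Ω]
    (μ : Measure Ω) (X : ι → Ω → ℝ≥0) (f : (ι → ℝ≥0) → ℝ≥0) (T : Strategy ι) : ℝ≥0∞ :=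
  ∫⁻ ω, (f (reveal (T.path (fun i => X i ω)) (fun i => X i ω)) : ℝ≥0∞) ∂μ

/-- `E[f(X_F)]` for a sequence `F` fixed in advance. -/
noncomputable def nonadaptiveReward {ι Ω : Type*} [DecidableEq ι] [MeasurableSpace Ω]
    (μ : Measure Ω) (X : ι → Ω → ℝ≥0) (f : (ι → ℝ≥0) → ℝ≥0) (F : List ι) : ℝ≥0∞ :=
  ∫⁻ ω, (f (reveal F (fun i => X i ω)) : ℝ≥0∞) ∂μ

/-- The optimal expected reward over all feasible adaptive strategies. -/
noncomputable def optAdaptive {ι Ω : Type*} [DecidableEq ι] [MeasurableSpace Ω]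
    (μ : Measure Ω) (X : ι → Ω → ℝ≥0) (f : (ι → ℝ≥0) → ℝ≥0) (𝓕 : Set (List ι)) : ℝ≥0∞ :=
  ⨆ (T : Strategy ι) (_ : T.Feasible 𝓕) (_ : T.IsMeasurable), adaptiveReward μ X f T

/-- The optimal expected reward over all feasible non-adaptive strategies. -/
noncomputable def optNonadaptive {ι Ω : Type*} [DecidableEq ι] [MeasurableSpace Ω]
    (μ : Measure Ω) (X : ι → Ω → ℝ≥0) (f : (ι → ℝ≥0) → ℝ≥0) (𝓕 : Set (List ι)) : ℝ≥0∞ :=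
  ⨆ F ∈ 𝓕, nonadaptiveReward μ X f F

end StochasticProbing

/-! Let `B` bound every non-adaptive reward and let `c` be the norm of a unit vector. The point is
to compare the adaptive reward along its realized path `F` with the non-adaptive reward of the same
`F` on fresh samples. The latter is at most `B` for every `F`, because every path is feasible.
Values are split at `s = 4B/c`.

Large values: by Markov, a fixed `F` shows no value above `s` with probability at least 1/2. The
means of the parts above `s`, summed over `F`, are therefore at most `2B/c` (`sum_large_le`). A Wald
identity (`lintegral_path_sum`) carries this to the adaptive sum, and the triangle inequality to the
norm.

Small values: at each dyadic level below `s`, let `N` count the probed values above the level and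
let `A` be the sum of their exceedance probabilities along the path. The exponential supermartingale
bound gives `E exp(N - 2A) ≤ 1`, so `N` exceeds `2A` by only a constant on average. If `A ≥ 4`,
fresh samples of `F` show more than `A/4` such values with probability at least 1/2. Jensen then
yields a vector `w` with `f w ≤ B` that is at least half the level on all ranks up to `A/4`
(`exists_profile`). Repeating the entries of `w` eight times covers ranks up to about `2A`, at the
price of a constant times `B`. Uncovered ranks number at most `8 + exp(N - 2A)` per level
(`card_bad_le`). Each is charged `c` times the level, and the levels form a geometric series, so
this costs `O(c * s) = O(B)`. -/

namespace StochasticProbing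

/-! ### Decision trees: resampling the root, Wald's identity, supermartingale products. -/

section Trees

variable {ι : Type*}

/-- The non-adaptive strategy that probes a fixed list. -/
def Strategy.ofList (F : List ι) : Strategy ι :=
  F.foldr (fun i T => .probe i fun _ => T) .leaf

theorem Strategy.path_ofList (F : List ι) (x : ι → ℝ≥0) : (Strategy.ofList F).path x = F := by
  induction F with
  | nil => rfl
  | cons a F ih => exact congrArg (a :: ·) ih

/-- The path of a decision tree does not depend on the variables it does not probe. -/
theorem Strategy.path_update_of_notMem [DecidableEq ι] (T : Strategy ι) (x : ι → ℝ≥0) (i : ι)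
    (v : ℝ≥0) (h : i ∉ T.path x) : T.path (Function.update x i v) = T.path x := by
  induction T with
  | leaf => rfl
  | probe j next ih =>
    simp only [Strategy.path, List.mem_cons, not_or] at h ⊢
    rw [Function.update_of_ne (Ne.symm h.1)]
    rw [ih _ h.2]

theorem Strategy.IsMeasurable.measurable_path_comp [Countable ι] {T : Strategy ι}
    (hT : T.IsMeasurable) {β : Type*} [MeasurableSpace β] {G : List ι → (ι → ℝ≥0) → β}
    (hG : ∀ F, Measurable (G F)) : Measurable fun x => G (T.path x) x := by
  intro s hs
  have : (fun x => G (T.path x) x) ⁻¹' s = ⋃ F, {x | T.path x = F} ∩ G F ⁻¹' s := by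
    ext x; simp
  rw [this]
  exact MeasurableSet.iUnion fun F => (hT F).inter (hG F hs)

/-- At `x` itself the hypothesis only concerns the branch `next (x i)`. Overwriting coordinate `i`
by `v` enters the branch `next v`. As `i` is not probed there, restoring the coordinate does not
alter the path. -/
theorem Strategy.notMem_path_next [DecidableEq ι] {i : ι} {next : ℝ≥0 → Strategy ι}
    (h : ∀ x, ((Strategy.probe i next).path x).Nodup) (v : ℝ≥0) (x : ι → ℝ≥0) :
    i ∉ (next v).path x := by
  have h1 := h (Function.update x i v)
  simp only [Strategy.path, Function.update_self, List.nodup_cons] at h1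
  have h2 := (next v).path_update_of_notMem (Function.update x i v) i (x i) h1.1
  simp only [Function.update_idem, Function.update_eq_self] at h2
  rw [h2]
  exact h1.1

theorem Strategy.path_probe_update [DecidableEq ι] {i : ι} {next : ℝ≥0 → Strategy ι}
    (h : ∀ x, ((Strategy.probe i next).path x).Nodup) (v : ℝ≥0) (x : ι → ℝ≥0) :
    (Strategy.probe i next).path (Function.update x i v) = i :: (next v).path x := by
  simp only [Strategy.path, Function.update_self]
  rw [(next v).path_update_of_notMem x i v (Strategy.notMem_path_next h v x)]

theorem Strategy.nodup_path_next [DecidableEq ι] {i : ι} {next : ℝ≥0 → Strategy ι}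
    (h : ∀ x, ((Strategy.probe i next).path x).Nodup) (v : ℝ≥0) (x : ι → ℝ≥0) :
    ((next v).path x).Nodup := by
  have := h (Function.update x i v)
  rw [Strategy.path_probe_update h] at this
  exact this.of_cons

theorem Strategy.IsMeasurable.next [DecidableEq ι] {i : ι} {next : ℝ≥0 → Strategy ι}
    (hT : (Strategy.probe i next).IsMeasurable)
    (h : ∀ x, ((Strategy.probe i next).path x).Nodup) (v : ℝ≥0) : (next v).IsMeasurable := by
  intro F
  have : {x | (next v).path x = F} =
      (fun x => Function.update x i v) ⁻¹' {x | (Strategy.probe i next).path x = i :: F} := by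
    ext x
    simp only [Set.mem_ofPred_eq, Set.mem_preimage, Strategy.path_probe_update h]
    simp
  rw [this]
  exact measurable_update_left (hT _)

variable [Fintype ι] [DecidableEq ι] (ν : ι → Measure ℝ≥0) [∀ i, IsProbabilityMeasure (ν i)]

/-- Resampling one coordinate of a product measure. -/
theorem lintegral_pi_update (i : ι) {G : (ι → ℝ≥0) → ℝ≥0∞} (hG : Measurable G) :
    ∫⁻ x, G x ∂Measure.pi ν = ∫⁻ v, ∫⁻ x, G (Function.update x i v) ∂Measure.pi ν ∂ν i := by
  have hm : Measurable fun p : (ι → ℝ≥0) × ℝ≥0 => G (Function.update p.1 i p.2) :=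
    hG.comp measurable_update'
  rw [lintegral_lintegral_swap (f := fun v x => G (Function.update x i v))
    (hm.comp measurable_swap).aemeasurable]
  have h1 : ∀ x, ∫⁻ v, G (Function.update x i v) ∂ν i = (∫⋯∫⁻_{i}, G ∂ν) x := fun x => by
    rw [lmarginal_singleton]
  simp only [h1]
  rw [lintegral_eq_lmarginal_univ (0 : ι → ℝ≥0), lintegral_eq_lmarginal_univ (0 : ι → ℝ≥0)]
  have hu : (Finset.univ : Finset ι) = (Finset.univ.erase i) ∪ {i} := by
    ext j; by_cases hj : j = i <;> simp [hj]
  have hd : Disjoint (Finset.univ.erase i) {i} := by simp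
  -- The inner marginal no longer depends on coordinate `i`, so integrating that coordinate again
  -- changes nothing.
  have key : (∫⋯∫⁻_{i}, (∫⋯∫⁻_{i}, G ∂ν) ∂ν) = ∫⋯∫⁻_{i}, G ∂ν := by
    funext x
    rw [lmarginal_singleton]
    simp only [lmarginal_singleton, Function.update_idem]
    simp
  rw [hu, lmarginal_union ν G hG hd, lmarginal_union ν _ (hG.lmarginal ν) hd, key]

/-- The expected sum of the observed values equals the expected sum of their means. -/
theorem Strategy.lintegral_path_sum (T : Strategy ι) (hT : T.IsMeasurable)
    (hnd : ∀ x, (T.path x).Nodup) {g : ι → ℝ≥0 → ℝ≥0∞} (hg : ∀ i, Measurable (g i)) :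
    ∫⁻ x, ((T.path x).map fun i => g i (x i)).sum ∂Measure.pi ν =
      ∫⁻ x, ((T.path x).map fun i => ∫⁻ v, g i v ∂ν i).sum ∂Measure.pi ν := by
  induction T with
  | leaf => simp [Strategy.path]
  | probe i next ih =>
    have hm1 : ∀ F : List ι, Measurable fun x : ι → ℝ≥0 => (F.map fun i => g i (x i)).sum := by
      intro F
      induction F with
      | nil => simp
      | cons a F ihF =>
        simp only [List.map_cons, List.sum_cons]
        exact ((hg a).comp (measurable_pi_apply a)).add ihF
    rw [lintegral_pi_update ν i (hT.measurable_path_comp hm1),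
      lintegral_pi_update ν i (hT.measurable_path_comp (G := fun F _ =>
        (F.map fun i => ∫⁻ v, g i v ∂ν i).sum) fun F => measurable_const)]
    have h1 : ∀ (v : ℝ≥0) (x : ι → ℝ≥0),
        (((Strategy.probe i next).path (Function.update x i v)).map
          fun j => g j (Function.update x i v j)).sum =
        g i v + (((next v).path x).map fun j => g j (x j)).sum := by
      intro v x
      rw [Strategy.path_probe_update hnd, List.map_cons, List.sum_cons, Function.update_self]
      congr 2
      refine List.map_congr_left fun j hj => ?_
      rw [Function.update_of_ne]
      rintro rfl
      exact Strategy.notMem_path_next hnd v x hj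
    simp only [h1]
    simp only [Strategy.path_probe_update hnd, List.map_cons, List.sum_cons]
    have h2 : ∀ v, ∫⁻ x, (g i v + (((next v).path x).map fun j => g j (x j)).sum) ∂Measure.pi ν =
        g i v + ∫⁻ x, (((next v).path x).map fun j => ∫⁻ v, g j v ∂ν j).sum ∂Measure.pi ν := by
      intro v
      rw [lintegral_add_left measurable_const, lintegral_const, measure_univ, mul_one,
        ih v (hT.next hnd v) (Strategy.nodup_path_next hnd v)]
    have h3 : ∀ v, ∫⁻ x, ((∫⁻ v, g i v ∂ν i) +
        (((next v).path x).map fun j => ∫⁻ v, g j v ∂ν j).sum) ∂Measure.pi ν =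
        (∫⁻ v, g i v ∂ν i) +
        ∫⁻ x, (((next v).path x).map fun j => ∫⁻ v, g j v ∂ν j).sum ∂Measure.pi ν := by
      intro v
      rw [lintegral_add_left measurable_const, lintegral_const, measure_univ, mul_one]
    simp only [h2, h3]
    rw [lintegral_add_left (hg i), lintegral_add_left measurable_const, lintegral_const,
      measure_univ, mul_one]

/-- The product of factors of mean at most one along an adaptive path has mean at most one. -/
theorem Strategy.lintegral_path_prod_le (T : Strategy ι) (hT : T.IsMeasurable)
    (hnd : ∀ x, (T.path x).Nodup) {Z : ι → ℝ≥0 → ℝ≥0∞} (hZ : ∀ i, Measurable (Z i))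
    (hZ1 : ∀ i, ∫⁻ v, Z i v ∂ν i ≤ 1) :
    ∫⁻ x, ((T.path x).map fun i => Z i (x i)).prod ∂Measure.pi ν ≤ 1 := by
  induction T with
  | leaf => simp [Strategy.path]
  | probe i next ih =>
    have hm1 : ∀ F : List ι, Measurable fun x : ι → ℝ≥0 => (F.map fun i => Z i (x i)).prod := by
      intro F
      induction F with
      | nil => simp
      | cons a F ihF =>
        simp only [List.map_cons, List.prod_cons]
        exact ((hZ a).comp (measurable_pi_apply a)).mul ihF
    rw [lintegral_pi_update ν i (hT.measurable_path_comp hm1)]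
    have h1 : ∀ (v : ℝ≥0) (x : ι → ℝ≥0),
        (((Strategy.probe i next).path (Function.update x i v)).map
          fun j => Z j (Function.update x i v j)).prod =
        Z i v * (((next v).path x).map fun j => Z j (x j)).prod := by
      intro v x
      rw [Strategy.path_probe_update hnd, List.map_cons, List.prod_cons, Function.update_self]
      congr 2
      refine List.map_congr_left fun j hj => ?_
      rw [Function.update_of_ne]
      rintro rfl
      exact Strategy.notMem_path_next hnd v x hj
    simp only [h1]
    calc ∫⁻ v, ∫⁻ x, Z i v * (((next v).path x).map fun j => Z j (x j)).prod ∂Measure.pi ν ∂ν i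
        ≤ ∫⁻ v, Z i v ∂ν i := by
          refine lintegral_mono fun v => ?_
          have hv := hT.next hnd v
          rw [lintegral_const_mul _ (hv.measurable_path_comp hm1)]
          exact mul_le_of_le_one_right' (ih v hv (Strategy.nodup_path_next hnd v))
      _ ≤ 1 := hZ1 i

end Trees

/-! ### Symmetric norms: comparison with sums and maxima, rearrangement, stretching, Jensen. -/

section Norms

namespace IsSymmetricNorm

variable {ι : Type*} {f : (ι → ℝ≥0) → ℝ≥0}

theorem sum_le (hf : IsSymmetricNorm f) {α : Type*} (s : Finset α) (v : α → ι → ℝ≥0) :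
    f (∑ a ∈ s, v a) ≤ ∑ a ∈ s, f (v a) := by
  classical
  induction s using Finset.induction_on with
  | empty => simp [hf.map_zero]
  | insert a s ha ih =>
    rw [Finset.sum_insert ha, Finset.sum_insert ha]
    exact (hf.subadd _ _).trans (by gcongr)

theorem single_eq [DecidableEq ι] (hf : IsSymmetricNorm f) (i j : ι) (a : ℝ≥0) :
    f (Pi.single i a) = a * f (Pi.single j 1) := by
  rw [← hf.homog, ← hf.symm (Equiv.swap i j)]
  congr 1
  funext k
  simp only [Pi.smul_apply, smul_eq_mul, Pi.single_apply]
  by_cases hk : k = j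
  · subst hk; simp
  · rw [if_neg hk, if_neg, mul_zero]
    intro h
    apply hk
    rw [Equiv.swap_apply_eq_iff] at h
    simpa using h

theorem le_mul_sum [Fintype ι] [DecidableEq ι] (hf : IsSymmetricNorm f) (i : ι) (v : ι → ℝ≥0) :
    f v ≤ f (Pi.single i 1) * ∑ j, v j := by
  calc f v = f (∑ j, Pi.single j (v j)) := by rw [Finset.univ_sum_single]
    _ ≤ ∑ j, f (Pi.single j (v j)) := hf.sum_le _ _
    _ = _ := by
      rw [Finset.mul_sum]
      exact Finset.sum_congr rfl fun j _ => by rw [hf.single_eq j i, mul_comm]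

theorem mul_le [DecidableEq ι] (hf : IsSymmetricNorm f) (i j : ι) (v : ι → ℝ≥0) :
    v i * f (Pi.single j 1) ≤ f v := by
  rw [← hf.single_eq i]
  refine hf.mono _ _ fun k => ?_
  by_cases hk : k = i
  · subst hk; simp
  · simp [Pi.single_eq_of_ne hk]

/-- Domination up to an injective relabelling of the support. -/
theorem le_of_injOn [Fintype ι] [DecidableEq ι] (hf : IsSymmetricNorm f) {s : Finset ι} {φ : ι → ι}
    (hφ : Set.InjOn φ s) {u v : ι → ℝ≥0} (hs : ∀ i ∈ s, u i ≤ v (φ i)) (h0 : ∀ i ∉ s, u i = 0) :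
    f u ≤ f v := by
  obtain ⟨g, hg⟩ := Finset.exists_equiv_extend_of_card_eq (t := (Finset.univ : Finset ι))
    (by simp) (s := s) (f := φ) (by simp) hφ
  let π : Equiv.Perm ι := g.trans (Equiv.subtypeUnivEquiv (by simp))
  rw [← hf.symm π v]
  refine hf.mono _ _ fun i => ?_
  by_cases hi : i ∈ s
  · have : π i = φ i := hg i hi
    rw [this]
    exact hs i hi
  · rw [h0 i hi]; exact zero_le

/-- Repeating each coordinate at most `m` times multiplies the norm by at most `m`. -/
theorem stretch_le {n : ℕ} {f : (Fin n → ℝ≥0) → ℝ≥0} (hf : IsSymmetricNorm f) {m : ℕ} (hm : 0 < m)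
    (w : Fin n → ℝ≥0) :
    f (fun j => w ⟨j / m, (Nat.div_le_self _ _).trans_lt j.2⟩) ≤ m * f w := by
  let d : Fin n → Fin n := fun j => ⟨j / m, (Nat.div_le_self _ _).trans_lt j.2⟩
  let u : ℕ → Fin n → ℝ≥0 := fun r j => if (j : ℕ) % m = r then w (d j) else 0
  -- Split the ranks by residue mod `m`: on one residue class, division by `m` is injective, so each
  -- piece is a relabelled part of `w`.
  have hsum : (fun j => w (d j)) = ∑ r ∈ Finset.range m, u r := by
    funext j
    simp only [Finset.sum_apply, u]
    rw [Finset.sum_ite_eq, if_pos (Finset.mem_range.2 (Nat.mod_lt _ hm))]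
  have hle : ∀ r, f (u r) ≤ f w := by
    intro r
    refine hf.le_of_injOn (s := Finset.univ.filter fun j : Fin n => (j : ℕ) % m = r) (φ := d)
      ?_ ?_ ?_
    · intro a ha b hb hab
      simp only [Finset.coe_filter, Finset.mem_univ, true_and, Set.mem_ofPred_eq] at ha hb
      have h1 : (a : ℕ) / m = b / m := congrArg Fin.val hab
      apply Fin.ext
      rw [← Nat.div_add_mod (a : ℕ) m, ← Nat.div_add_mod (b : ℕ) m, h1, ha, hb]
    · intro j hj
      simp [u, (Finset.mem_filter.1 hj).2]
    · intro j hj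
      simp only [Finset.mem_filter, Finset.mem_univ, true_and] at hj
      simp [u, hj]
  calc f (fun j => w (d j)) = f (∑ r ∈ Finset.range m, u r) := by rw [hsum]
    _ ≤ ∑ r ∈ Finset.range m, f (u r) := hf.sum_le _ _
    _ ≤ ∑ r ∈ Finset.range m, f w := Finset.sum_le_sum fun r _ => hle r
    _ = m * f w := by simp

/-- Jensen's inequality for random vectors with finitely many values. -/
theorem simpleFunc_jensen (hf : IsSymmetricNorm f) {Ω : Type*} [MeasurableSpace Ω] (μ : Measure Ω)
    [IsProbabilityMeasure μ] (Y : SimpleFunc Ω (ι → ℝ≥0)) :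
    (f (fun k => (∫⁻ ω, (Y ω k : ℝ≥0∞) ∂μ).toNNReal) : ℝ≥0∞) ≤ ∫⁻ ω, (f (Y ω) : ℝ≥0∞) ∂μ := by
  have key : ∀ g : (ι → ℝ≥0) → ℝ≥0, ∫⁻ ω, (g (Y ω) : ℝ≥0∞) ∂μ =
      ((∑ y ∈ Y.range, (μ (Y ⁻¹' {y})).toNNReal * g y : ℝ≥0) : ℝ≥0∞) := by
    intro g
    have h1 := SimpleFunc.lintegral_eq_lintegral (Y.map fun y => (g y : ℝ≥0∞)) μ
    rw [SimpleFunc.map_lintegral] at h1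
    simp only [SimpleFunc.coe_map, Function.comp_apply] at h1
    rw [h1]
    push_cast
    refine Finset.sum_congr rfl fun y _ => ?_
    rw [ENNReal.coe_toNNReal (measure_ne_top _ _), mul_comm]
  rw [key f]
  have h2 : (fun k => (∫⁻ ω, (Y ω k : ℝ≥0∞) ∂μ).toNNReal) =
      ∑ y ∈ Y.range, (μ (Y ⁻¹' {y})).toNNReal • y := by
    funext k
    rw [key fun y => y k, ENNReal.toNNReal_coe]
    simp
  rw [h2]
  refine ENNReal.coe_le_coe.2 ((hf.sum_le _ _).trans (Finset.sum_le_sum fun y _ => ?_))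
  rw [hf.homog]

end IsSymmetricNorm

/-- Every finite vector has a decreasing rearrangement, whose `k`-th entry exceeds `t` exactly if
more than `k` entries of the vector exceed `t`. -/
theorem exists_perm_lt_iff {n : ℕ} (v : Fin n → ℝ≥0) : ∃ σ : Equiv.Perm (Fin n),
    ∀ (k : Fin n) (t : ℝ≥0), t < v (σ k) ↔ (k : ℕ) < (Finset.univ.filter fun i => t < v i).card := by
  let σ := Tuple.sort (fun i => OrderDual.toDual (v i))
  have hσ : Antitone fun k => v (σ k) := fun a b hab =>
    Tuple.monotone_sort (fun i => OrderDual.toDual (v i)) hab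
  refine ⟨σ, fun k t => ?_⟩
  have hc : (Finset.univ.filter fun i => t < v i).card =
      (Finset.univ.filter fun i => t < v (σ i)).card := by
    rw [← Finset.card_map σ.toEmbedding (s := Finset.univ.filter fun i => t < v (σ i))]
    congr 1
    ext i
    simp only [Finset.mem_map, Finset.mem_filter, Finset.mem_univ, true_and,
      Equiv.coe_toEmbedding]
    constructor
    · intro hi
      exact ⟨σ.symm i, by simpa using hi, by simp⟩
    · rintro ⟨a, ha, rfl⟩
      exact ha
  rw [hc]
  constructor
  · intro h
    have : Finset.Iic k ⊆ Finset.univ.filter fun i => t < v (σ i) := fun i hi => by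
      simpa using h.trans_le (hσ (Finset.mem_Iic.1 hi))
    have := Finset.card_le_card this
    rw [Fin.card_Iic] at this
    omega
  · intro h
    by_contra hk
    have : (Finset.univ.filter fun i => t < v (σ i)) ⊆ Finset.Iio k := fun i hi => by
      rw [Finset.mem_Iio]
      by_contra hik
      exact hk ((Finset.mem_filter.1 hi).2.trans_le (hσ (not_lt.1 hik)))
    have := Finset.card_le_card this
    rw [Fin.card_Iio] at this
    omega

end Norms

/-! ### Exceedance counts: exponential moments and the profile of a fixed list. -/

section Counts

variable {ι : Type*}

/-- The number of entries of `F` whose value exceeds `τ`. -/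
noncomputable def exceedCount (τ : ℝ≥0) (F : List ι) (x : ι → ℝ≥0) : ℕ :=
  F.countP fun i => decide (τ < x i)

/-- The expected number of entries of `F` whose value exceeds `τ`. -/
noncomputable def exceedMass (ν : ι → Measure ℝ≥0) (τ : ℝ≥0) (F : List ι) : ℝ :=
  (F.map fun i => (ν i).real (Set.Ioi τ)).sum

theorem exceedCount_cons (τ : ℝ≥0) (i : ι) (F : List ι) (x : ι → ℝ≥0) :
    exceedCount τ (i :: F) x = exceedCount τ F x + if τ < x i then 1 else 0 := by
  simp [exceedCount, List.countP_cons]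

theorem measurable_exceedCount (τ : ℝ≥0) (F : List ι) : Measurable (exceedCount τ F) := by
  induction F with
  | nil => exact measurable_const
  | cons i F ih =>
    have : exceedCount τ (i :: F) = fun x => exceedCount τ F x + if τ < x i then 1 else 0 :=
      funext fun x => exceedCount_cons τ i F x
    rw [this]
    exact ih.add (Measurable.ite (measurableSet_lt measurable_const (measurable_pi_apply i))
      measurable_const measurable_const)

theorem exceedCount_le_length (τ : ℝ≥0) (F : List ι) (x : ι → ℝ≥0) :
    exceedCount τ F x ≤ F.length := List.countP_le_length

theorem card_reveal_gt [Fintype ι] [DecidableEq ι] (τ : ℝ≥0) {F : List ι} (hF : F.Nodup)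
    (x : ι → ℝ≥0) :
    (Finset.univ.filter fun i => τ < reveal F x i).card = exceedCount τ F x := by
  rw [exceedCount, List.countP_eq_length_filter,
    ← List.toFinset_card_of_nodup (hF.filter _)]
  congr 1
  ext i
  rw [Finset.mem_filter]
  by_cases hi : i ∈ F <;> simp [reveal, hi]

theorem prod_exp_exceed (ν : ι → Measure ℝ≥0) (τ : ℝ≥0) (a b : ℝ) (F : List ι) (x : ι → ℝ≥0) :
    (F.map fun i => ENNReal.ofReal
      (Real.exp (a * (if τ < x i then 1 else 0) + b * (ν i).real (Set.Ioi τ)))).prod =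
    ENNReal.ofReal (Real.exp (a * exceedCount τ F x + b * exceedMass ν τ F)) := by
  induction F with
  | nil => simp [exceedCount, exceedMass]
  | cons i F ih =>
    rw [List.map_cons, List.prod_cons, ih, ← ENNReal.ofReal_mul (Real.exp_nonneg _),
      ← Real.exp_add, exceedCount_cons]
    simp only [exceedMass, List.map_cons, List.sum_cons]
    push_cast
    congr 2
    ring

/-- With `p` the exceedance probability, the integral equals `(1 + (exp a - 1) p) exp (b p)`, and `1
+ t ≤ exp t` bounds this by `exp ((exp a - 1 + b) p)`. -/
theorem lintegral_exp_indicator_le (ν : Measure ℝ≥0) [IsProbabilityMeasure ν] (τ : ℝ≥0) {a b : ℝ}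
    (hab : Real.exp a - 1 + b ≤ 0) :
    ∫⁻ v, ENNReal.ofReal
      (Real.exp (a * (if τ < v then 1 else 0) + b * ν.real (Set.Ioi τ))) ∂ν ≤ 1 := by
  set p := ν.real (Set.Ioi τ) with hp
  have hp0 : 0 ≤ p := measureReal_nonneg
  have h1 : ∀ v : ℝ≥0, Real.exp (a * (if τ < v then 1 else 0) + b * p) =
      Real.exp (b * p) + (Set.Ioi τ).indicator
        (fun _ => (Real.exp a - 1) * Real.exp (b * p)) v := by
    intro v
    by_cases hv : τ < v
    · rw [if_pos hv, Set.indicator_of_mem (show v ∈ Set.Ioi τ from hv), Real.exp_add]; ring_nf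
    · rw [if_neg hv, Set.indicator_of_notMem (show v ∉ Set.Ioi τ from hv)]; simp
  have hi : Integrable (fun v : ℝ≥0 => Real.exp (b * p) + (Set.Ioi τ).indicator
        (fun _ => (Real.exp a - 1) * Real.exp (b * p)) v) ν :=
    (integrable_const _).add ((integrable_const _).indicator measurableSet_Ioi)
  simp only [h1]
  rw [← ofReal_integral_eq_lintegral_ofReal hi
    (Filter.Eventually.of_forall fun v => by
      simp only [Pi.zero_apply]; rw [← h1 v]; positivity)]
  rw [ENNReal.ofReal_le_one, integral_add (integrable_const _)
    ((integrable_const _).indicator measurableSet_Ioi), integral_indicator_const _ measurableSet_Ioi,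
    ← hp]
  simp only [integral_const, probReal_univ, smul_eq_mul, one_mul]
  calc Real.exp (b * p) + p * ((Real.exp a - 1) * Real.exp (b * p))
      = ((Real.exp a - 1) * p + 1) * Real.exp (b * p) := by ring
    _ ≤ Real.exp ((Real.exp a - 1) * p) * Real.exp (b * p) := by
      gcongr; exact Real.add_one_le_exp _
    _ = Real.exp ((Real.exp a - 1 + b) * p) := by rw [← Real.exp_add]; ring_nf
    _ ≤ 1 := by
      rw [Real.exp_le_one_iff]
      exact mul_nonpos_of_nonpos_of_nonneg hab hp0

variable [Fintype ι] [DecidableEq ι] (ν : ι → Measure ℝ≥0) [∀ i, IsProbabilityMeasure (ν i)]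

/-- Exponential moment bound for the number of large values seen by an adaptive strategy, relative
to its compensator. -/
theorem Strategy.lintegral_exp_exceed_le (T : Strategy ι) (hT : T.IsMeasurable)
    (hnd : ∀ x, (T.path x).Nodup) (τ : ℝ≥0) {a b : ℝ} (hab : Real.exp a - 1 + b ≤ 0) :
    ∫⁻ x, ENNReal.ofReal (Real.exp
      (a * exceedCount τ (T.path x) x + b * exceedMass ν τ (T.path x))) ∂Measure.pi ν ≤ 1 := by
  simp only [← prod_exp_exceed]
  refine T.lintegral_path_prod_le ν hT hnd (Z := fun i v => ENNReal.ofReal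
      (Real.exp (a * (if τ < v then 1 else 0) + b * (ν i).real (Set.Ioi τ)))) (fun i => ?_)
    fun i => lintegral_exp_indicator_le (ν i) τ hab
  refine ENNReal.measurable_ofReal.comp (Real.measurable_exp.comp ?_)
  exact ((Measurable.ite measurableSet_Ioi measurable_const measurable_const).const_mul a).add_const _

/-- Chernoff lower tail for a constant tree, with `a = -1` and `b = 1/2`: on the event the exponent
is at least `-A/4 + A/2 = A/4 ≥ 1`, so the exponential is at least 2 while its mean is at most 1. -/
theorem measure_exceedCount_le (F : List ι) (hF : F.Nodup) (τ : ℝ≥0) (k : ℕ)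
    (h4 : 4 ≤ exceedMass ν τ F) (hk : (k : ℝ) ≤ exceedMass ν τ F / 4) :
    2 * Measure.pi ν {x | exceedCount τ F x ≤ k} ≤ 1 := by
  have hT : (Strategy.ofList F).IsMeasurable := fun G => by
    simp only [Strategy.path_ofList]; exact MeasurableSet.const _
  have h1 := (Strategy.ofList F).lintegral_exp_exceed_le ν hT
    (fun x => by rwa [Strategy.path_ofList]) τ (a := -1) (b := 1 / 2) (by
      have : Real.exp (-1) ≤ 1 / 2 := by
        rw [Real.exp_neg, inv_le_comm₀ (Real.exp_pos 1) (by norm_num)]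
        have := Real.add_one_le_exp (1 : ℝ)
        norm_num at this ⊢
        exact this
      linarith)
  simp only [Strategy.path_ofList] at h1
  refine le_trans ?_ h1
  have hm : MeasurableSet {x : ι → ℝ≥0 | exceedCount τ F x ≤ k} :=
    measurable_exceedCount τ F measurableSet_Iic
  rw [← lintegral_indicator_const hm]
  refine lintegral_mono fun x => ?_
  by_cases hx : exceedCount τ F x ≤ k
  · rw [Set.indicator_of_mem (show x ∈ {x | exceedCount τ F x ≤ k} from hx)]
    have hx' : (exceedCount τ F x : ℝ) ≤ k := by exact_mod_cast hx
    rw [show (2 : ℝ≥0∞) = ENNReal.ofReal 2 by simp]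
    refine ENNReal.ofReal_le_ofReal ?_
    refine le_trans ?_ (Real.add_one_le_exp _)
    linarith
  · rw [Set.indicator_of_notMem (show x ∉ {x | exceedCount τ F x ≤ k} from hx)]
    exact zero_le

/-- For each list `F` there is a vector whose norm is at most the expected norm of `X_F` and which
has many large entries at each level at which `X_F` has many large entries in expectation. -/
theorem exists_profile {n : ℕ} (ν : Fin n → Measure ℝ≥0) [∀ i, IsProbabilityMeasure (ν i)]
    {f : (Fin n → ℝ≥0) → ℝ≥0} (hf : IsSymmetricNorm f) {F : List (Fin n)} (hF : F.Nodup)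
    (L : Finset ℝ≥0) : ∃ w : Fin n → ℝ≥0,
      (f w : ℝ≥0∞) ≤ ∫⁻ x, (f (reveal F x) : ℝ≥0∞) ∂Measure.pi ν ∧
      ∀ τ ∈ L, ∀ k : Fin n, 4 ≤ exceedMass ν τ F → ((k : ℕ) : ℝ) ≤ exceedMass ν τ F / 4 →
        τ ≤ 2 * w k := by
  -- The counts at the levels in `L` take finitely many values, so any vector built from them is a
  -- simple function. Jensen is then a finite sum and needs no measurability of `f`.
  let C : SimpleFunc (Fin n → ℝ≥0) (L → Fin (F.length + 1)) :=
    { toFun := fun x τ => ⟨exceedCount τ F x, Nat.lt_succ_of_le (exceedCount_le_length _ _ _)⟩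
      measurableSet_fiber' := fun c => by
        have : (fun (x : Fin n → ℝ≥0) (τ : L) => (⟨exceedCount τ F x,
            Nat.lt_succ_of_le (exceedCount_le_length _ _ _)⟩ : Fin (F.length + 1))) ⁻¹' {c} =
            ⋂ τ : L, exceedCount τ F ⁻¹' {(c τ : ℕ)} := by
          ext x
          simp [funext_iff, Fin.ext_iff]
        rw [this]
        exact MeasurableSet.iInter fun τ => measurable_exceedCount _ _ (measurableSet_singleton _)
      finite_range' := Set.toFinite _ }
  -- A discretized decreasing rearrangement of `X_F`: entry `k` is the largest level in `L` exceeded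
  -- by more than `k` values. The witness `w` is its mean.
  let Y : SimpleFunc (Fin n → ℝ≥0) (Fin n → ℝ≥0) := C.map fun c k =>
    Finset.univ.sup fun τ : L => if (k : ℕ) < c τ then (τ : ℝ≥0) else 0
  have hY : ∀ x k, Y x k = Finset.univ.sup fun τ : L =>
    if (k : ℕ) < exceedCount τ F x then (τ : ℝ≥0) else 0 := fun x k => rfl
  refine ⟨fun k => (∫⁻ x, (Y x k : ℝ≥0∞) ∂Measure.pi ν).toNNReal,
    (hf.simpleFunc_jensen _ Y).trans (lintegral_mono fun x => ENNReal.coe_le_coe.2 ?_), ?_⟩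
  · obtain ⟨σ, hσ⟩ := exists_perm_lt_iff (reveal F x)
    rw [← hf.symm σ (reveal F x)]
    refine hf.mono _ _ fun k => ?_
    rw [hY]
    refine Finset.sup_le fun τ _ => ?_
    split_ifs with h
    · rw [← card_reveal_gt _ hF, ← hσ] at h
      exact h.le
    · exact zero_le
  · intro τ hτ k h4 hk
    have hm := measure_exceedCount_le ν F hF τ k h4 hk
    have hfin : ∫⁻ x, (Y x k : ℝ≥0∞) ∂Measure.pi ν ≠ ∞ := by
      refine ne_of_lt (lt_of_le_of_lt (lintegral_mono (g := fun _ => ((L.sup id : ℝ≥0) : ℝ≥0∞))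
        fun x => ENNReal.coe_le_coe.2 ?_) ?_)
      · rw [hY]
        refine Finset.sup_le fun τ _ => ?_
        split_ifs with h
        · exact Finset.le_sup (f := id) τ.2
        · exact zero_le
      · simp
    have hlow : (τ : ℝ≥0∞) * Measure.pi ν {x | exceedCount τ F x ≤ k}ᶜ ≤
        ∫⁻ x, (Y x k : ℝ≥0∞) ∂Measure.pi ν := by
      have hms : MeasurableSet {x : Fin n → ℝ≥0 | exceedCount τ F x ≤ k} :=
        measurable_exceedCount τ F measurableSet_Iic
      rw [← lintegral_indicator_const hms.compl]
      refine lintegral_mono fun x => ?_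
      by_cases hx : exceedCount τ F x ≤ k
      · rw [Set.indicator_of_notMem (by simpa using hx)]; exact zero_le
      · rw [Set.indicator_of_mem (by simpa using hx)]
        refine ENNReal.coe_le_coe.2 ?_
        rw [hY]
        have := Finset.le_sup (s := Finset.univ) (b := (⟨τ, hτ⟩ : L)) (f := fun τ : L =>
          if (k : ℕ) < exceedCount τ F x then (τ : ℝ≥0) else 0) (Finset.mem_univ _)
        rwa [if_pos (not_le.1 hx)] at this
    have hhalf : 1 ≤ 2 * Measure.pi ν {x | exceedCount τ F x ≤ k}ᶜ := by
      have h1 := prob_add_prob_compl (μ := Measure.pi ν)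
        (s := {x | exceedCount τ F x ≤ k}) (measurable_exceedCount τ F measurableSet_Iic)
      have h2 : 1 + 2 * Measure.pi ν {x | exceedCount τ F x ≤ k}ᶜ ≥ 1 + 1 := by
        calc (1 : ℝ≥0∞) + 1 = 2 * (Measure.pi ν {x | exceedCount τ F x ≤ k} +
              Measure.pi ν {x | exceedCount τ F x ≤ k}ᶜ) := by rw [h1, mul_one, one_add_one_eq_two]
          _ ≤ _ := by rw [mul_add]; gcongr
      exact (ENNReal.add_le_add_iff_left ENNReal.one_ne_top).1 h2
    rw [← ENNReal.coe_le_coe, ENNReal.coe_mul, ENNReal.coe_toNNReal hfin]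
    calc (τ : ℝ≥0∞) = τ * 1 := (mul_one _).symm
      _ ≤ τ * (2 * Measure.pi ν {x | exceedCount τ F x ≤ k}ᶜ) := by gcongr
      _ = 2 * (τ * Measure.pi ν {x | exceedCount τ F x ≤ k}ᶜ) := by ring
      _ ≤ _ := by push_cast; gcongr

end Counts

/-! ### Small values: covering ranks level by level. -/

section Small

/-- A bounded vector is controlled by a profile vector `w`, up to an error that counts at each
dyadic level the ranks not covered by `w`. -/
theorem IsSymmetricNorm.le_profile_add {n : ℕ} {f : (Fin n → ℝ≥0) → ℝ≥0} (hf : IsSymmetricNorm f)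
    (i₀ : Fin n) {u w : Fin n → ℝ≥0} {s : ℝ≥0} (hu : ∀ i, u i ≤ s) (M : ℕ) {N : ℕ → ℕ}
    (hN : ∀ l, (Finset.univ.filter fun i => s / 2 ^ (l + 1) < u i).card ≤ N l) (A : ℕ → ℝ)
    (hw : ∀ l < M, ∀ k : Fin n, 4 ≤ A l → ((k : ℕ) : ℝ) ≤ A l / 4 →
      s / 2 ^ (l + 1) ≤ 2 * w k) :
    f u ≤ 32 * f w + f (Pi.single i₀ 1) * (n * (s / 2 ^ M) + ∑ l ∈ Finset.range M,
      s / 2 ^ l * ((Finset.univ.filter fun j : Fin n => (j : ℕ) < N l ∧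
        ¬ (4 ≤ A l ∧ (((j : ℕ) / 8 : ℕ) : ℝ) ≤ A l / 4)).card : ℝ≥0)) := by
  obtain ⟨σ, hσ⟩ := exists_perm_lt_iff u
  let bad : ℕ → Fin n → Prop := fun l j => (j : ℕ) < N l ∧
    ¬ (4 ≤ A l ∧ (((j : ℕ) / 8 : ℕ) : ℝ) ≤ A l / 4)
  classical
  let w' : Fin n → ℝ≥0 := fun j => w ⟨j / 8, (Nat.div_le_self _ _).trans_lt j.2⟩
  let r : Fin n → ℝ≥0 := fun j =>
    s / 2 ^ M + ∑ l ∈ Finset.range M, if bad l j then s / 2 ^ l else 0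
  have hpt : (fun j => u (σ j)) ≤ (4 : ℝ≥0) • w' + r := by
    intro j
    simp only [Pi.add_apply, Pi.smul_apply, smul_eq_mul, r, w']
    by_cases hj : u (σ j) ≤ s / 2 ^ M
    · exact hj.trans (le_trans le_self_add le_add_self)
    have hM : M ≠ 0 := by
      rintro rfl
      exact hj (by simpa using hu (σ j))
    have hex : ∃ l, s / 2 ^ (l + 1) < u (σ j) :=
      ⟨M - 1, by rw [Nat.sub_add_cancel (Nat.pos_of_ne_zero hM)]; exact not_le.1 hj⟩
    -- The dyadic bracket of the value: minimality of `l` gives `s / 2 ^ (l + 1) < u (σ j) ≤ s / 2 ^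
    -- l`.
    let l := Nat.find hex
    have hl : s / 2 ^ (l + 1) < u (σ j) := Nat.find_spec hex
    have hlM : l < M := by
      have : l ≤ M - 1 := Nat.find_min' hex
        (by rw [Nat.sub_add_cancel (Nat.pos_of_ne_zero hM)]; exact not_le.1 hj)
      omega
    have hul : u (σ j) ≤ s / 2 ^ l := by
      rcases Nat.eq_zero_or_pos l with h0 | h0
      · rw [h0]; simpa using hu (σ j)
      · have := Nat.find_min hex (m := l - 1) (by omega)
        rw [Nat.sub_add_cancel h0] at this
        exact not_lt.1 this
    have hjN : (j : ℕ) < N l := ((hσ j _).1 hl).trans_le (hN l)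
    by_cases hb : bad l j
    · calc u (σ j) ≤ if bad l j then s / 2 ^ l else 0 := by rwa [if_pos hb]
        _ ≤ ∑ l ∈ Finset.range M, if bad l j then s / 2 ^ l else 0 :=
          Finset.single_le_sum (f := fun l => if bad l j then s / 2 ^ l else 0)
            (fun _ _ => zero_le) (Finset.mem_range.2 hlM)
        _ ≤ _ := le_add_self.trans le_add_self
    · have hgood : 4 ≤ A l ∧ (((j : ℕ) / 8 : ℕ) : ℝ) ≤ A l / 4 := by
        by_contra h
        exact hb ⟨hjN, h⟩
      have := hw l hlM ⟨j / 8, (Nat.div_le_self _ _).trans_lt j.2⟩ hgood.1 hgood.2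
      refine le_trans ?_ le_self_add
      -- The factor 4 is 2 for the width of the dyadic bracket times 2 for the half lost in the
      -- profile.
      calc u (σ j) ≤ s / 2 ^ l := hul
        _ = 2 * (s / 2 ^ (l + 1)) := by rw [pow_succ]; field_simp
        _ ≤ 2 * (2 * w ⟨j / 8, (Nat.div_le_self _ _).trans_lt j.2⟩) := by gcongr
        _ = _ := by rw [← mul_assoc]; norm_num
  have hr : ∑ j, r j = n * (s / 2 ^ M) + ∑ l ∈ Finset.range M, s / 2 ^ l *
      ((Finset.univ.filter fun j : Fin n => bad l j).card : ℝ≥0) := by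
    simp only [r]
    rw [Finset.sum_add_distrib, Finset.sum_comm]
    congr 1
    · simp
    · refine Finset.sum_congr rfl fun l _ => ?_
      rw [← Finset.sum_filter, Finset.sum_const, nsmul_eq_mul, mul_comm]
  calc f u = f (fun j => u (σ j)) := (hf.symm σ u).symm
    _ ≤ f ((4 : ℝ≥0) • w' + r) := hf.mono _ _ hpt
    _ ≤ f ((4 : ℝ≥0) • w') + f r := hf.subadd _ _
    _ ≤ 4 * ((8 : ℕ) * f w) + f (Pi.single i₀ 1) * ∑ j, r j := by
      rw [hf.homog]
      gcongr
      · exact hf.stretch_le (by norm_num) w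
      · exact hf.le_mul_sum i₀ r
    _ = _ := by
      rw [hr, ← mul_assoc, show (4 : ℝ≥0) * (8 : ℕ) = 32 by norm_num]

/-- If `A ≥ 4`, an uncovered `j` has `j / 8 > A / 4` and so `j > 2A`, leaving at most `max (N - 2A)
0` indices. If `A < 4`, the trivial count `N` is below `(N - 2A) + 8`. In both cases use `t ≤ exp
t`. -/
theorem card_bad_le {n : ℕ} (N : ℕ) (A : ℝ) :
    (((Finset.univ.filter fun j : Fin n => (j : ℕ) < N ∧
      ¬ (4 ≤ A ∧ (((j : ℕ) / 8 : ℕ) : ℝ) ≤ A / 4)).card : ℕ) : ℝ) ≤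
      8 + Real.exp (N - 2 * A) := by
  have hexp : (N : ℝ) - 2 * A ≤ Real.exp (N - 2 * A) :=
    le_trans (by linarith) (Real.add_one_le_exp _)
  have h0 := Real.exp_pos (N - 2 * A)
  rw [← Finset.card_map Fin.valEmbedding]
  by_cases h4 : 4 ≤ A
  · have hsub : (Finset.univ.filter fun j : Fin n => (j : ℕ) < N ∧
      ¬ (4 ≤ A ∧ (((j : ℕ) / 8 : ℕ) : ℝ) ≤ A / 4)).map Fin.valEmbedding ⊆
        Finset.Ico (⌊2 * A⌋₊ + 1) N := by
      intro a ha
      obtain ⟨j, hj, rfl⟩ := Finset.mem_map.1 ha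
      obtain ⟨h1, h2⟩ := (Finset.mem_filter.1 hj).2
      have h3 : A / 4 < (((j : ℕ) / 8 : ℕ) : ℝ) := by
        by_contra h
        exact h2 ⟨h4, not_lt.1 h⟩
      have h5 : (((8 * ((j : ℕ) / 8) : ℕ)) : ℝ) ≤ ((j : ℕ) : ℝ) := by
        exact_mod_cast Nat.mul_div_le _ _
      push_cast at h5 h3
      rw [Finset.mem_Ico]
      refine ⟨Nat.succ_le_of_lt ((Nat.floor_lt (by positivity)).2 ?_), h1⟩
      simp only [Fin.valEmbedding_apply]
      linarith
    have hcard := Finset.card_le_card hsub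
    rw [Nat.card_Ico] at hcard
    have hfl := Nat.lt_floor_add_one (2 * A)
    refine le_trans (Nat.cast_le.2 hcard) ?_
    rcases le_total (⌊2 * A⌋₊ + 1) N with h | h
    · rw [Nat.cast_sub h]; push_cast; linarith
    · rw [Nat.sub_eq_zero_of_le h]; push_cast; linarith
  · have hsub : (Finset.univ.filter fun j : Fin n => (j : ℕ) < N ∧
      ¬ (4 ≤ A ∧ (((j : ℕ) / 8 : ℕ) : ℝ) ≤ A / 4)).map Fin.valEmbedding ⊆ Finset.range N := by
      intro a ha
      obtain ⟨j, hj, rfl⟩ := Finset.mem_map.1 ha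
      exact Finset.mem_range.2 (Finset.mem_filter.1 hj).2.1
    have hcard := Finset.card_le_card hsub
    rw [Finset.card_range] at hcard
    refine le_trans (Nat.cast_le.2 hcard) ?_
    linarith [not_le.1 h4]

end Small

/-! ### Large values: they are rare on every fixed list. -/

section Large

variable {ι : Type*} [Fintype ι] [DecidableEq ι] (ν : ι → Measure ℝ≥0)
  [∀ i, IsProbabilityMeasure (ν i)]

/-- If values above `s` are rarely seen on `F`, their total expected size is controlled by the
expected norm. -/
theorem IsSymmetricNorm.sum_large_le {f : (ι → ℝ≥0) → ℝ≥0} (hf : IsSymmetricNorm f) (i₀ : ι)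
    {F : List ι} (hF : F.Nodup) {B s : ℝ≥0} (hB : 0 < B)
    (hs : 2 * B ≤ s * f (Pi.single i₀ 1))
    (hFB : ∫⁻ x, (f (reveal F x) : ℝ≥0∞) ∂Measure.pi ν ≤ B) :
    (f (Pi.single i₀ 1) : ℝ≥0∞) *
      (F.map fun i => ∫⁻ v, (Set.Ioi s).indicator (fun v => (v : ℝ≥0∞)) v ∂ν i).sum ≤ 2 * B := by
  set c := f (Pi.single i₀ 1) with hc
  set g : ℝ≥0 → ℝ≥0∞ := (Set.Ioi s).indicator (fun v => (v : ℝ≥0∞)) with hg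
  have hgm : Measurable g := measurable_coe_nnreal_ennreal.indicator measurableSet_Ioi
  let G : Set (ι → ℝ≥0) := {x | ∀ j ∈ F, x j ≤ s}
  -- `G' i` ignores coordinate `i`, hence is independent of it, and contains `G`, hence has
  -- probability at least 1/2. At any outcome at most one `i` has both `x i > s` and `x ∈ G' i`, so
  -- the sum over `i` collapses to one term.
  let G' : ι → Set (ι → ℝ≥0) := fun i => {x | ∀ j ∈ F, j ≠ i → x j ≤ s}
  have hGm : MeasurableSet G := by
    have : G = ⋂ j, ⋂ (_ : j ∈ F), {x | x j ≤ s} := by ext; simp [G]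
    rw [this]
    exact MeasurableSet.iInter fun j => MeasurableSet.iInter fun _ =>
      measurableSet_le (measurable_pi_apply j) measurable_const
  have hG'm : ∀ i, MeasurableSet (G' i) := by
    intro i
    have : G' i = ⋂ j, ⋂ (_ : j ∈ F), ⋂ (_ : j ≠ i), {x | x j ≤ s} := by ext; simp [G']
    rw [this]
    exact MeasurableSet.iInter fun j => MeasurableSet.iInter fun _ => MeasurableSet.iInter fun _ =>
      measurableSet_le (measurable_pi_apply j) measurable_const
  have hreveal : ∀ x : ι → ℝ≥0, ∀ i ∈ F, c * x i ≤ f (reveal F x) := by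
    intro x i hi
    have := hf.mul_le i i₀ (reveal F x)
    rwa [reveal, if_pos hi, mul_comm] at this
  have hprob : 1 ≤ 2 * Measure.pi ν G := by
    have h1 : (2 * B : ℝ≥0∞) * Measure.pi ν Gᶜ ≤ B := by
      refine le_trans ?_ hFB
      rw [← lintegral_indicator_const hGm.compl]
      refine lintegral_mono fun x => ?_
      by_cases hx : x ∈ G
      · rw [Set.indicator_of_notMem (by simpa using hx)]; exact zero_le
      · rw [Set.indicator_of_mem (by simpa using hx)]
        simp only [G, Set.mem_ofPred_eq, not_forall, not_le] at hx
        obtain ⟨j, hj, hjs⟩ := hx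
        have : 2 * B ≤ f (reveal F x) := hs.trans (le_trans
          (by rw [mul_comm]; gcongr) (hreveal x j hj))
        simpa using ENNReal.coe_le_coe.2 this
    have h2 : 2 * Measure.pi ν Gᶜ ≤ 1 := by
      have hB0 : (B : ℝ≥0∞) ≠ 0 := by exact_mod_cast hB.ne'
      rw [← ENNReal.mul_le_mul_iff_right hB0 ENNReal.coe_ne_top, mul_one]
      calc (B : ℝ≥0∞) * (2 * Measure.pi ν Gᶜ) = 2 * B * Measure.pi ν Gᶜ := by ring
        _ ≤ B := h1
    have h3 := prob_add_prob_compl (μ := Measure.pi ν) hGm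
    refine (ENNReal.add_le_add_iff_right (a := 1) ENNReal.one_ne_top).1 ?_
    calc (1 : ℝ≥0∞) + 1 = 2 * (Measure.pi ν G + Measure.pi ν Gᶜ) := by
          rw [h3, mul_one, one_add_one_eq_two]
      _ ≤ _ := by rw [mul_add]; gcongr
  have hterm : ∀ i, ∫⁻ x, g (x i) * (G' i).indicator 1 x ∂Measure.pi ν =
      (∫⁻ v, g v ∂ν i) * Measure.pi ν (G' i) := by
    intro i
    have hG'1 : Measurable ((G' i).indicator (1 : (ι → ℝ≥0) → ℝ≥0∞)) :=
      measurable_one.indicator (hG'm i)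
    rw [lintegral_pi_update ν i (G := fun x => g (x i) * (G' i).indicator 1 x)
      ((hgm.comp (measurable_pi_apply i)).mul hG'1)]
    have h1 : ∀ (v : ℝ≥0) (x : ι → ℝ≥0), (G' i).indicator (1 : (ι → ℝ≥0) → ℝ≥0∞)
        (Function.update x i v) = (G' i).indicator 1 x := by
      intro v x
      have : Function.update x i v ∈ G' i ↔ x ∈ G' i := by
        simp only [G', Set.mem_ofPred_eq]
        refine forall_congr' fun j => forall_congr' fun _ => forall_congr' fun hji => ?_
        rw [Function.update_of_ne hji]
      by_cases hx : x ∈ G' i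
      · rw [Set.indicator_of_mem hx, Set.indicator_of_mem (this.2 hx)]; rfl
      · rw [Set.indicator_of_notMem hx, Set.indicator_of_notMem (fun h => hx (this.1 h))]
    simp only [h1, Function.update_self]
    simp only [lintegral_const_mul _ hG'1, lintegral_indicator_one (hG'm i)]
    rw [lintegral_mul_const _ hgm]
  have hpt : ∀ x : ι → ℝ≥0, (c : ℝ≥0∞) * ∑ i ∈ F.toFinset, g (x i) * (G' i).indicator 1 x ≤
      f (reveal F x) := by
    intro x
    by_cases h : ∃ i ∈ F.toFinset, g (x i) * (G' i).indicator 1 x ≠ 0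
    · obtain ⟨i, hi, hne⟩ := h
      have hxG : x ∈ G' i := by
        by_contra hx
        exact hne (by rw [Set.indicator_of_notMem hx, mul_zero])
      rw [Finset.sum_eq_single_of_mem i hi, Set.indicator_of_mem hxG]
      · simp only [Pi.one_apply, mul_one]
        have h1 : g (x i) ≤ x i := Set.indicator_le_self' (fun _ _ => zero_le) _
        calc (c : ℝ≥0∞) * g (x i) ≤ c * x i := by gcongr
          _ ≤ _ := by exact_mod_cast hreveal x i (List.mem_toFinset.1 hi)
      · intro j hj hji
        rw [hg, Set.indicator_of_notMem, zero_mul]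
        exact not_lt.2 (hxG j (List.mem_toFinset.1 hj) hji)
    · push Not at h
      rw [Finset.sum_eq_zero h, mul_zero]
      exact zero_le
  have hmain : (c : ℝ≥0∞) * ∑ i ∈ F.toFinset, (∫⁻ v, g v ∂ν i) * Measure.pi ν (G' i) ≤ B := by
    refine le_trans ?_ hFB
    refine le_trans (le_of_eq ?_) (lintegral_mono hpt)
    have hm : ∀ i ∈ F.toFinset, Measurable fun x : ι → ℝ≥0 => g (x i) * (G' i).indicator 1 x :=
      fun i _ => (hgm.comp (measurable_pi_apply i)).mul (measurable_one.indicator (hG'm i))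
    rw [lintegral_const_mul _ (Finset.measurable_fun_sum _ hm), lintegral_finsetSum _ hm]
    simp only [hterm]
  rw [← List.sum_toFinset _ hF]
  calc (c : ℝ≥0∞) * ∑ i ∈ F.toFinset, ∫⁻ v, g v ∂ν i
      ≤ c * ∑ i ∈ F.toFinset, (∫⁻ v, g v ∂ν i) * (2 * Measure.pi ν (G' i)) := by
        gcongr with i hi
        refine le_mul_of_one_le_right' (hprob.trans ?_)
        gcongr
        exact fun x hx j hj _ => hx j hj
    _ = 2 * (c * ∑ i ∈ F.toFinset, (∫⁻ v, g v ∂ν i) * Measure.pi ν (G' i)) := by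
        rw [mul_left_comm (2 : ℝ≥0∞), Finset.mul_sum (a := (2 : ℝ≥0∞)) ]
        congr 1
        exact Finset.sum_congr rfl fun i _ => mul_left_comm _ _ _
    _ ≤ 2 * B := by gcongr

end Large

/-! ### Assembling the bound on the adaptivity gap. -/

section Gap

/-- Disposes of the degenerate cases, no coordinates or null unit vectors, in which the threshold `4
* B / c` is not meaningful. -/
theorem IsSymmetricNorm.eq_zero {ι : Type*} [Fintype ι] [DecidableEq ι] {f : (ι → ℝ≥0) → ℝ≥0}
    (hf : IsSymmetricNorm f) (h : ∀ i, f (Pi.single i 1) = 0) (v : ι → ℝ≥0) : f v = 0 := by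
  by_cases hι : IsEmpty ι
  · rw [Subsingleton.elim v 0, hf.map_zero]
  · obtain ⟨i⟩ := not_isEmpty_iff.1 hι
    have := hf.le_mul_sum i v
    rwa [h i, zero_mul, nonpos_iff_eq_zero] at this

/-- The contribution of the values at most `s`, in terms of the profile of the probed path. -/
theorem IsSymmetricNorm.small_part_le {n : ℕ} (ν : Fin n → Measure ℝ≥0)
    [∀ i, IsProbabilityMeasure (ν i)] {f : (Fin n → ℝ≥0) → ℝ≥0} (hf : IsSymmetricNorm f)
    (i₀ : Fin n) (s B : ℝ≥0) {F : List (Fin n)} (hF : F.Nodup)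
    (hFB : ∫⁻ x, (f (reveal F x) : ℝ≥0∞) ∂Measure.pi ν ≤ B) (x : Fin n → ℝ≥0) :
    (f (fun i => if reveal F x i ≤ s then reveal F x i else 0) : ℝ≥0∞) ≤
      32 * B + f (Pi.single i₀ 1) * (s + ∑ l ∈ Finset.range n, (s / 2 ^ l : ℝ≥0) *
        (8 + ENNReal.ofReal (Real.exp (1 * exceedCount (s / 2 ^ (l + 1)) F x +
          (-2) * exceedMass ν (s / 2 ^ (l + 1)) F)))) := by
  -- The profile belongs to the list `F` alone; only the counts in the error term see the outcome
  -- `x`.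
  obtain ⟨w, hwB, hw⟩ := exists_profile ν hf hF
    ((Finset.range n).image fun l => s / 2 ^ (l + 1))
  have hwB' : f w ≤ B := by exact_mod_cast hwB.trans hFB
  have h1 := hf.le_profile_add i₀ (u := fun i => if reveal F x i ≤ s then reveal F x i else 0)
    (w := w) (s := s) (fun i => by split_ifs with h; exacts [h, zero_le]) n
    (N := fun l => exceedCount (s / 2 ^ (l + 1)) F x)
    (fun l => by
      rw [← card_reveal_gt _ hF]
      refine Finset.card_le_card fun i hi => ?_
      rw [Finset.mem_filter] at hi ⊢
      refine ⟨hi.1, hi.2.trans_le ?_⟩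
      split_ifs
      exacts [le_rfl, zero_le])
    (fun l => exceedMass ν (s / 2 ^ (l + 1)) F)
    (fun l hl k => hw _ (Finset.mem_image_of_mem _ (Finset.mem_range.2 hl)) k)
  refine (ENNReal.coe_le_coe.2 h1).trans ?_
  simp only [ENNReal.coe_add, ENNReal.coe_mul, ENNReal.ofNNReal_finsetSum, ENNReal.coe_ofNat]
  gcongr with l hl
  · rw [← ENNReal.coe_mul, ENNReal.coe_le_coe]
    calc (n : ℝ≥0) * (s / 2 ^ n) ≤ 2 ^ n * (s / 2 ^ n) := by
          gcongr; exact_mod_cast Nat.lt_two_pow_self.le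
      _ = s := by field_simp
  · have := card_bad_le (n := n) (exceedCount (s / 2 ^ (l + 1)) F x)
      (exceedMass ν (s / 2 ^ (l + 1)) F)
    rw [ENNReal.coe_natCast, ← ENNReal.ofReal_natCast, show (8 : ℝ≥0∞) = ENNReal.ofReal 8 by simp,
      ← ENNReal.ofReal_add (by norm_num) (Real.exp_nonneg _)]
    refine ENNReal.ofReal_le_ofReal (this.trans (le_of_eq ?_))
    ring_nf

theorem sum_half_pow_le (s : ℝ≥0) (n : ℕ) : ∑ l ∈ Finset.range n, s / 2 ^ l ≤ 2 * s := by
  have h : ∀ m, ∑ l ∈ Finset.range m, s / 2 ^ l + 2 * s / 2 ^ m = 2 * s := by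
    intro m
    induction m with
    | zero => simp
    | succ m ih =>
      rw [Finset.sum_range_succ, add_assoc]
      convert ih using 2
      rw [pow_succ]
      field_simp
      norm_num
  exact le_self_add.trans (h n).le

/-- The reward of a feasible adaptive strategy is dominated by a random variable whose mean is at
most a constant times any bound on the non-adaptive rewards. -/
theorem Strategy.exists_dominating {n : ℕ} (ν : Fin n → Measure ℝ≥0)
    [∀ i, IsProbabilityMeasure (ν i)] {f : (Fin n → ℝ≥0) → ℝ≥0} (hf : IsSymmetricNorm f)
    {i₀ : Fin n} (hi₀ : f (Pi.single i₀ 1) ≠ 0) {𝓕 : Set (List (Fin n))} (h𝓕 : IsPrefixClosed 𝓕)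
    {B : ℝ≥0} (hB : 0 < B)
    (hFB : ∀ F ∈ 𝓕, ∫⁻ x, (f (reveal F x) : ℝ≥0∞) ∂Measure.pi ν ≤ B)
    {T : Strategy (Fin n)} (hT : T.Feasible 𝓕) (hTm : T.IsMeasurable) :
    ∃ H : (Fin n → ℝ≥0) → ℝ≥0∞, Measurable H ∧
      (∀ x, (f (reveal (T.path x) x) : ℝ≥0∞) ≤ H x) ∧ ∫⁻ x, H x ∂Measure.pi ν ≤ 110 * B := by
  set c := f (Pi.single i₀ 1) with hc
  -- The large-value bound only needs `c * s ≥ 2 * B`.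
  let s : ℝ≥0 := 4 * B / c
  have hcs : c * s = 4 * B := by simp only [s]; field_simp
  have hnd : ∀ x, (T.path x).Nodup := fun x => h𝓕.nodup _ (hT x)
  let g : ℝ≥0 → ℝ≥0∞ := (Set.Ioi s).indicator (fun v => (v : ℝ≥0∞))
  have hgm : Measurable g := measurable_coe_nnreal_ennreal.indicator measurableSet_Ioi
  let E : ℕ → (Fin n → ℝ≥0) → ℝ≥0∞ := fun l x =>
    ENNReal.ofReal (Real.exp (1 * exceedCount (s / 2 ^ (l + 1)) (T.path x) x +
          (-2) * exceedMass ν (s / 2 ^ (l + 1)) (T.path x)))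
  let S : (Fin n → ℝ≥0) → ℝ≥0∞ := fun x => ((T.path x).map fun i => g (x i)).sum
  have hEm : ∀ l, Measurable (E l) := fun l => by
    refine hTm.measurable_path_comp (G := fun F x => ENNReal.ofReal (Real.exp
      (1 * exceedCount (s / 2 ^ (l + 1)) F x + (-2) * exceedMass ν (s / 2 ^ (l + 1)) F)))
      fun F => ENNReal.measurable_ofReal.comp (Real.measurable_exp.comp ?_)
    exact ((measurable_from_top.comp (measurable_exceedCount _ F)).const_mul 1).add_const _
  have hSm : Measurable S := by
    refine hTm.measurable_path_comp (G := fun F x => (F.map fun i => g (x i)).sum) fun F => ?_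
    induction F with
    | nil => simp
    | cons a F ih =>
      simp only [List.map_cons, List.sum_cons]
      exact (hgm.comp (measurable_pi_apply a)).add ih
  have hE1 : ∀ l, ∫⁻ x, E l x ∂Measure.pi ν ≤ 1 := fun l =>
    T.lintegral_exp_exceed_le ν hTm hnd _ (by
      have := Real.exp_one_lt_d9
      linarith)
  have hS : c * ∫⁻ x, S x ∂Measure.pi ν ≤ 2 * B := by
    -- After replacing observed values by their means, the fixed-list bound applies to each realized
    -- path separately.
    have hSeq := T.lintegral_path_sum ν hTm hnd (g := fun _ => g) fun _ => hgm
    calc (c : ℝ≥0∞) * ∫⁻ x, S x ∂Measure.pi ν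
        = ∫⁻ x, c * ((T.path x).map fun i => ∫⁻ v, g v ∂ν i).sum ∂Measure.pi ν := by
          rw [hSeq, lintegral_const_mul' _ _ ENNReal.coe_ne_top]
      _ ≤ ∫⁻ _, 2 * B ∂Measure.pi ν := by
          refine lintegral_mono fun x => ?_
          refine hf.sum_large_le ν i₀ (hnd x) hB ?_ (hFB _ (hT x))
          rw [mul_comm s, ← hc, hcs]
          gcongr
          norm_num
      _ = 2 * B := by simp
  have hDm : ∀ l ∈ Finset.range n, Measurable fun x => ((s / 2 ^ l : ℝ≥0) : ℝ≥0∞) * (8 + E l x) :=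
    fun l _ => ((hEm l).const_add 8).const_mul _
  have hsum : ∫⁻ x, ∑ l ∈ Finset.range n, ((s / 2 ^ l : ℝ≥0) : ℝ≥0∞) * (8 + E l x) ∂Measure.pi ν ≤
      18 * s := by
    rw [lintegral_finsetSum _ hDm]
    calc ∑ l ∈ Finset.range n, ∫⁻ x, ((s / 2 ^ l : ℝ≥0) : ℝ≥0∞) * (8 + E l x) ∂Measure.pi ν
        ≤ ∑ l ∈ Finset.range n, ((s / 2 ^ l : ℝ≥0) : ℝ≥0∞) * 9 := by
          refine Finset.sum_le_sum fun l _ => ?_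
          rw [lintegral_const_mul _ ((hEm l).const_add 8), lintegral_add_left measurable_const,
            lintegral_const, measure_univ, mul_one]
          gcongr
          calc (8 : ℝ≥0∞) + ∫⁻ x, E l x ∂Measure.pi ν ≤ 8 + 1 := by gcongr; exact hE1 l
            _ = 9 := by norm_num
      _ = ((∑ l ∈ Finset.range n, s / 2 ^ l : ℝ≥0) : ℝ≥0∞) * 9 := by
          rw [← Finset.sum_mul, ENNReal.ofNNReal_finsetSum]
      _ ≤ ((2 * s : ℝ≥0) : ℝ≥0∞) * 9 := by
          gcongr
          exact sum_half_pow_le s n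
      _ = 18 * s := by push_cast; ring
  refine ⟨fun x => (32 * B + c * (s + ∑ l ∈ Finset.range n,
    ((s / 2 ^ l : ℝ≥0) : ℝ≥0∞) * (8 + E l x))) + c * S x, ?_, fun x => ?_, ?_⟩
  · exact ((((Finset.measurable_fun_sum _ hDm).const_add _).const_mul _).const_add _).add
      (hSm.const_mul _)
  · have hsplit : reveal (T.path x) x =
        (fun i => if reveal (T.path x) x i ≤ s then reveal (T.path x) x i else 0) +
        (fun i => if reveal (T.path x) x i ≤ s then 0 else reveal (T.path x) x i) := by
      funext i
      simp only [Pi.add_apply]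
      split_ifs <;> simp
    have h1 := hf.subadd (fun i => if reveal (T.path x) x i ≤ s then reveal (T.path x) x i else 0)
      (fun i => if reveal (T.path x) x i ≤ s then 0 else reveal (T.path x) x i)
    rw [← hsplit] at h1
    refine (ENNReal.coe_le_coe.2 h1).trans ?_
    rw [ENNReal.coe_add]
    refine add_le_add (hf.small_part_le ν i₀ s B (hnd x) (hFB _ (hT x)) x) ?_
    refine (ENNReal.coe_le_coe.2 (hf.le_mul_sum i₀ _)).trans ?_
    rw [ENNReal.coe_mul, ENNReal.ofNNReal_finsetSum]
    gcongr
    simp only [S]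
    rw [← List.sum_toFinset _ (hnd x)]
    rw [← Finset.sum_subset (Finset.subset_univ (T.path x).toFinset)]
    · refine Finset.sum_le_sum fun i hi => ?_
      rw [reveal, if_pos (List.mem_toFinset.1 hi)]
      split_ifs with h
      · exact zero_le
      · exact (Set.indicator_of_mem (show x i ∈ Set.Ioi s from not_le.1 h) _).ge
    · intro i _ hi
      rw [List.mem_toFinset] at hi
      simp [reveal, hi]
  · rw [lintegral_add_right _ (hSm.const_mul _), lintegral_add_left measurable_const,
      lintegral_const_mul' _ _ ENNReal.coe_ne_top, lintegral_add_left measurable_const,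
      lintegral_const_mul' _ _ ENNReal.coe_ne_top]
    simp only [lintegral_const, measure_univ, mul_one]
    calc 32 * (B : ℝ≥0∞) + c * (s + ∫⁻ x, ∑ l ∈ Finset.range n,
          ((s / 2 ^ l : ℝ≥0) : ℝ≥0∞) * (8 + E l x) ∂Measure.pi ν) + c * ∫⁻ x, S x ∂Measure.pi ν
        ≤ 32 * B + c * (s + 18 * s) + 2 * B := by gcongr
      -- With `c * s = 4 * B` the total is `34 + 19 * 4 = 110` times `B`.
      _ = 34 * B + 19 * ((c * s : ℝ≥0) : ℝ≥0∞) := by push_cast; ring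
      _ = 110 * B := by rw [hcs]; push_cast; ring

/-- Transfers to the product of the laws. Since `f` is not assumed measurable, the adaptive reward
is passed through the measurable majorant `H`; for the fixed lists the inequality `lintegral_map_le`
points in the needed direction. -/
theorem adaptiveReward_le {n : ℕ} {Ω : Type*} [MeasurableSpace Ω] (μ : Measure Ω)
    [IsProbabilityMeasure μ] {X : Fin n → Ω → ℝ≥0} (hX : ∀ i, Measurable (X i))
    (hind : iIndepFun X μ) {f : (Fin n → ℝ≥0) → ℝ≥0} (hf : IsSymmetricNorm f)
    {𝓕 : Set (List (Fin n))} (h𝓕 : IsPrefixClosed 𝓕) {B : ℝ≥0} (hB : 0 < B)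
    (hopt : optNonadaptive μ X f 𝓕 ≤ B) {T : Strategy (Fin n)} (hT : T.Feasible 𝓕)
    (hTm : T.IsMeasurable) : adaptiveReward μ X f T ≤ 110 * B := by
  by_cases h0 : ∀ i, f (Pi.single i 1) = 0
  · simp [adaptiveReward, hf.eq_zero h0]
  push Not at h0
  obtain ⟨i₀, hi₀⟩ := h0
  have hXm : Measurable fun ω i => X i ω := measurable_pi_lambda _ hX
  have hmap : μ.map (fun ω i => X i ω) = Measure.pi fun i => μ.map (X i) :=
    (iIndepFun_iff_map_fun_eq_pi_map fun i => (hX i).aemeasurable).1 hind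
  have hprob : ∀ i, IsProbabilityMeasure (μ.map (X i)) := fun i =>
    Measure.isProbabilityMeasure_map (hX i).aemeasurable
  obtain ⟨H, hHm, hH, hHB⟩ := T.exists_dominating (fun i => μ.map (X i)) hf hi₀ h𝓕 hB
    (fun F hF => by
      rw [← hmap]
      refine (lintegral_map_le _ _).trans (le_trans ?_ hopt)
      exact le_iSup₂_of_le (f := fun F _ => nonadaptiveReward μ X f F) F hF le_rfl) hT hTm
  calc adaptiveReward μ X f T ≤ ∫⁻ ω, H (fun i => X i ω) ∂μ := lintegral_mono fun ω => hH _
    _ = ∫⁻ x, H x ∂Measure.pi fun i => μ.map (X i) := by rw [← hmap, lintegral_map hHm hXm]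
    _ ≤ 110 * B := hHB

end Gap

end StochasticProbing

/-- The adaptivity gap (optimal adaptive over optimal non-adaptive expected reward) of stochastic
probing with a monotone symmetric norm is bounded by a universal constant `C`. -/
theorem mainTheorem4 :
    ∃ C : ℝ≥0, ∀ (n : ℕ) (Ω : Type*) [MeasurableSpace Ω] (μ : Measure Ω) [IsProbabilityMeasure μ]
      (X : Fin n → Ω → ℝ≥0) (_ : ∀ i, Measurable (X i)) (_ : iIndepFun X μ)
      (f : (Fin n → ℝ≥0) → ℝ≥0) (_ : StochasticProbing.IsSymmetricNorm f)
      (𝓕 : Set (List (Fin n))) (_ : StochasticProbing.IsPrefixClosed 𝓕),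
      StochasticProbing.optAdaptive μ X f 𝓕 ≤ C * StochasticProbing.optNonadaptive μ X f 𝓕 := by
  refine ⟨110, fun n Ω _ μ _ X hX hind f hf 𝓕 h𝓕 => ?_⟩
  refine iSup_le fun T => iSup_le fun hT => iSup_le fun hTm => ?_
  have key := fun (B : ℝ≥0) hB hopt =>
    StochasticProbing.adaptiveReward_le (B := B) μ hX hind hf h𝓕 hB hopt hT hTm
  rw [ENNReal.coe_ofNat]
  rcases eq_or_ne (StochasticProbing.optNonadaptive μ X f 𝓕) ∞ with h | h
  · rw [h, ENNReal.mul_top (by norm_num)]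
    exact le_top
  -- The Markov step requires `B > 0`, but the non-adaptive optimum may vanish; hence the slack `ε /
  -- 110`.
  refine ENNReal.le_of_forall_pos_le_add fun ε hε _ => ?_
  refine (key ((StochasticProbing.optNonadaptive μ X f 𝓕).toNNReal + ε / 110) (by positivity) ?_).trans
    (le_of_eq ?_)
  · rw [ENNReal.coe_add, ENNReal.coe_toNNReal h]
    exact le_self_add
  · rw [ENNReal.coe_add, ENNReal.coe_toNNReal h, mul_add]
    congr 1
    rw [← ENNReal.coe_ofNat, ← ENNReal.coe_mul]
    congr 1
    field_simp
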